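/- Let $\Gamma$ be a finite simplicial graph with vertex set $V$, and let $A(\Gamma)=\langle\, a\in V \mid ab=ba \text{ whenever } a,b \text{ are adjacent in } \Gamma\,\rangle$ be the associated right-angled Artin group. A word is a finite sequence of letters from $V\cup V^{-1}$; $|w|$ denotes the number of letters of the word $w$, and $u^{-1}$ denotes the formal inverse of the word $u$. A word is reduced if no shorter word represents the same element of $A(\Gamma)$, and cyclically reduced if all of its cyclic permutations are reduced. A subword of $w$, considered as a cyclic word, is a block of consecutive letters in some cyclic permutation of $w$. Theorem. Let $g\in A(\Gamma)$ and let $n>0$ be an integer. Let $w$ be a cyclically reduced word representing the conjugacy class of $g^n$ in $A(\Gamma)$, and suppose that $u$ is a word such that both $u$ and $u^{-1}$ occur as subwords of $w$, considered as a cyclic word. Then $$|u|\ \le\ \frac{|w|}{2n}.$$ -/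

import Mathlib

namespace RAAG

variable {V : Type*}

/-- The defining relators `a b a⁻¹ b⁻¹`, one for each pair of adjacent vertices `a`, `b`. -/
def relators (Γ : SimpleGraph V) : Set (FreeGroup V) :=
  {r | ∃ a b : V, Γ.Adj a b ∧
    r = FreeGroup.of a * FreeGroup.of b * (FreeGroup.of a)⁻¹ * (FreeGroup.of b)⁻¹}

/-- The right-angled Artin group `A(Γ) = ⟨ a ∈ V | [a, b] = 1 if a and b are adjacent ⟩`. -/
abbrev ArtinGroup (Γ : SimpleGraph V) : Type _ :=
  PresentedGroup (relators Γ)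

/-- Words in the generators and their inverses: `(a, true)` is the letter `a`,
`(a, false)` is the letter `a⁻¹`. The formal inverse of a word `u` is `FreeGroup.invRev u`. -/
abbrev Word (V : Type*) : Type _ :=
  List (V × Bool)

/-- The element of `A(Γ)` represented by a word. -/
def eval (Γ : SimpleGraph V) (w : Word V) : ArtinGroup Γ :=
  PresentedGroup.mk (relators Γ) (FreeGroup.mk w)

/-- A word is reduced if no shorter word represents the same element of `A(Γ)`. -/
def IsReduced (Γ : SimpleGraph V) (w : Word V) : Prop :=
  ∀ v : Word V, eval Γ v = eval Γ w → w.length ≤ v.length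

/-- A word is cyclically reduced if all its cyclic permutations are reduced words
with respect to `A(Γ)` (not merely freely reduced). -/
def IsCyclicallyReduced (Γ : SimpleGraph V) (w : Word V) : Prop :=
  ∀ w' : Word V, w' ~r w → IsReduced Γ w'

/-- `u` is a subword of `w` considered as a cyclic word: it consists of consecutive letters
of some cyclic permutation of `w`. -/
def IsCyclicSubword (u w : Word V) : Prop :=
  ∃ w' : Word V, w' ~r w ∧ u <:+: w'

end RAAG

/-!
The argument takes place in the heap of a word: its letters, partially ordered by their succession
on pairs of non-adjacent (possibly equal) generators. The heap is recorded by the projections of the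
word to all such pairs (`proj`).

*From the group to heaps.* The group acts on the families of projections of cancellation-free words
(`permHom`), and a cancellation-free word takes the trivial family to its own projections. Hence
cancellation-free words which represent the same element have the same projections
(`CancelFree.proj_eq`). A cyclically reduced `w` conjugate to `g ^ n` can be written `(p h p⁻¹) ^ n`
with `h` and then `p` as short as possible. In that case `p hⁿ p⁻¹` is cancellation-free, so it has
the projections of `w`, and `p` is empty because `w` has no cancellation across its ends. So `w` and
`hⁿ` have the same projections (`IsCyclicallyReduced.exists_proj_eq`).

*Reflections of the heap.* Consequently the heap of the infinite repetition `W` of `w` has an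
automorphism which moves every occurrence of a generator `a` forward by `m a` occurrences of `a`,
where `m a` is the number of letters on `a` in `h` (`isHeapShift_periodicSeq`). Let `u` and its
formal inverse occupy the blocks `U` and `U'` of `W`, and let `σU'` be the image of `U'` under a
power of this automorphism. Reversing `U` onto `U'` and applying `σ` reverses the order and inverts
the letters, and it restricts to an involution of the intersection of `U` and `σU'`. Take two
letters which it interchanges, as close together as possible. They are inverse to each other, so
there is a letter between them that does not commute with them. This letter and its image lie in the
intersection and are closer together, a contradiction. Hence `U` is disjoint from all shifts of `U'`
(`IsHeapShift.not_shiftRel`).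

*Counting.* The occurrences of `a` are linearly ordered. Those in `U` and those in `U'` form two
intervals of equal length, and no translate of the second by a multiple of `m a` meets the first, so
that their length is at most `m a / 2` (`IsHeapShift.two_mul_genCount_le`). Multiplying by `n` and
summing over all generators gives the inequality.
-/

namespace RAAG

/-! ### Letters that can be moved to an end of a word -/

section Words

variable {V : Type*}

/-- The inverse letter. -/
def letterInv (x : V × Bool) : V × Bool := (x.1, !x.2)

@[simp] lemma letterInv_fst (x : V × Bool) : (letterInv x).1 = x.1 := rfl

@[simp] lemma letterInv_letterInv (x : V × Bool) : letterInv (letterInv x) = x := by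
  simp [letterInv]

lemma letterInv_ne (x : V × Bool) : letterInv x ≠ x := by
  intro h
  simpa [letterInv] using congrArg Prod.snd h

variable (Γ : SimpleGraph V)

/-- Some occurrence of the letter `x` in `w` is preceded only by letters on generators adjacent to
that of `x`, so that commutations move it to the front. -/
def StartsWith (x : V × Bool) (w : Word V) : Prop :=
  ∃ r s, w = r ++ x :: s ∧ ∀ y ∈ r, Γ.Adj x.1 y.1

/-- Some occurrence of the letter `x` in `w` can be moved to the end by commutations. -/
def EndsWith (x : V × Bool) (w : Word V) : Prop :=
  StartsWith Γ x w.reverse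

/-- No letter of the word can be cancelled against a later one by moving it there through letters
on adjacent generators. This is the combinatorial form of being reduced. -/
def CancelFree : Word V → Prop
  | [] => True
  | x :: w => ¬ StartsWith Γ (letterInv x) w ∧ CancelFree w

variable {Γ}

lemma not_startsWith_nil (x : V × Bool) : ¬ StartsWith Γ x [] := by
  rintro ⟨r, s, h, -⟩
  simp at h

lemma startsWith_cons {x y : V × Bool} {w : Word V} :
    StartsWith Γ x (y :: w) ↔ y = x ∨ (Γ.Adj x.1 y.1 ∧ StartsWith Γ x w) := by
  constructor
  · rintro ⟨r, s, h, hr⟩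
    cases r with
    | nil => simp at h; exact Or.inl h.1
    | cons z r =>
      simp at h
      obtain ⟨rfl, rfl⟩ := h
      exact Or.inr ⟨hr _ (by simp), r, s, rfl, fun y hy => hr y (by simp [hy])⟩
  · rintro (rfl | ⟨h, r, s, rfl, hr⟩)
    · exact ⟨[], w, rfl, by simp⟩
    · refine ⟨y :: r, s, rfl, ?_⟩
      simpa [h] using hr

lemma startsWith_append {x : V × Bool} {u v : Word V} :
    StartsWith Γ x (u ++ v) ↔
      StartsWith Γ x u ∨ ((∀ y ∈ u, Γ.Adj x.1 y.1) ∧ StartsWith Γ x v) := by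
  induction u with
  | nil => simp [not_startsWith_nil]
  | cons z u ih =>
    simp only [List.cons_append, startsWith_cons, ih, List.mem_cons, forall_eq_or_imp]
    tauto

lemma endsWith_append {x : V × Bool} {u v : Word V} :
    EndsWith Γ x (u ++ v) ↔
      EndsWith Γ x v ∨ ((∀ y ∈ v, Γ.Adj x.1 y.1) ∧ EndsWith Γ x u) := by
  simp [EndsWith, startsWith_append]

lemma endsWith_singleton {x y : V × Bool} : EndsWith Γ x [y] ↔ y = x := by
  simp [EndsWith, startsWith_cons, not_startsWith_nil]

lemma endsWith_cons {x y : V × Bool} {w : Word V} :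
    EndsWith Γ x (y :: w) ↔ EndsWith Γ x w ∨ ((∀ z ∈ w, Γ.Adj x.1 z.1) ∧ y = x) := by
  rw [← List.singleton_append, endsWith_append, endsWith_singleton]

lemma EndsWith.exists_eq {x : V × Bool} {w : Word V} (h : EndsWith Γ x w) :
    ∃ r s, w = r ++ x :: s ∧ ∀ y ∈ s, Γ.Adj x.1 y.1 := by
  obtain ⟨r, s, h, hr⟩ := h
  refine ⟨s.reverse, r.reverse, ?_, by simpa using hr⟩
  simpa using congrArg List.reverse h

lemma startsWith_map_letterInv {x : V × Bool} {w : Word V} :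
    StartsWith Γ (letterInv x) (w.map letterInv) ↔ StartsWith Γ x w := by
  induction w with
  | nil => simp [not_startsWith_nil]
  | cons y w ih =>
    have : letterInv y = letterInv x ↔ y = x :=
      ⟨fun h => by simpa using congrArg letterInv h, fun h => by rw [h]⟩
    simp [startsWith_cons, ih, this]

lemma startsWith_invRev {x : V × Bool} {w : Word V} :
    StartsWith Γ (letterInv x) (FreeGroup.invRev w) ↔ EndsWith Γ x w := by
  have : FreeGroup.invRev w = w.reverse.map letterInv := by
    simp [FreeGroup.invRev, letterInv]
  rw [this, startsWith_map_letterInv, EndsWith]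

lemma endsWith_invRev {x : V × Bool} {w : Word V} :
    EndsWith Γ (letterInv x) (FreeGroup.invRev w) ↔ StartsWith Γ x w := by
  have : (FreeGroup.invRev w).reverse = w.map letterInv := by
    simp [FreeGroup.invRev, letterInv]
  rw [EndsWith, this, startsWith_map_letterInv]

/-! ### Cancellation-free words -/

lemma cancelFree_append {u v : Word V} :
    CancelFree Γ (u ++ v) ↔ CancelFree Γ u ∧ CancelFree Γ v ∧
      ∀ x, EndsWith Γ x u → ¬ StartsWith Γ (letterInv x) v := by
  induction u with
  | nil => simp [CancelFree, EndsWith, not_startsWith_nil]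
  | cons y u ih =>
    simp only [List.cons_append, CancelFree, ih, startsWith_append, endsWith_cons, letterInv_fst]
    constructor
    · rintro ⟨h1, h2, h3, h4⟩
      refine ⟨⟨fun h => h1 (Or.inl h), h2⟩, h3, ?_⟩
      rintro x (h | ⟨h, rfl⟩)
      · exact h4 x h
      · exact fun h' => h1 (Or.inr ⟨h, h'⟩)
    · rintro ⟨⟨h1, h2⟩, h3, h4⟩
      refine ⟨?_, h2, h3, fun x h => h4 x (Or.inl h)⟩
      rintro (h | ⟨h, h'⟩)
      · exact h1 h
      · exact h4 y (Or.inr ⟨h, rfl⟩) h'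

lemma CancelFree.delete {r s : Word V} {x : V × Bool} (h : CancelFree Γ (r ++ x :: s))
    (hr : ∀ y ∈ r, Γ.Adj x.1 y.1) : CancelFree Γ (r ++ s) := by
  induction r with
  | nil => exact h.2
  | cons y r ih =>
    refine ⟨fun h' => h.1 ?_, ih h.2 fun z hz => hr z (by simp [hz])⟩
    have := hr y (by simp)
    change StartsWith Γ _ (r ++ x :: s)
    replace h' : StartsWith Γ _ (r ++ s) := h'
    rw [startsWith_append, startsWith_cons]
    rw [startsWith_append] at h'
    exact h'.imp_right fun ⟨h1, h2⟩ => ⟨h1, Or.inr ⟨this.symm, h2⟩⟩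

/-- In a cancellation-free word, deleting a letter that can be moved to the front does not
expose its inverse. -/
lemma CancelFree.not_startsWith_delete {r s : Word V} {x : V × Bool}
    (h : CancelFree Γ (r ++ x :: s)) (hr : ∀ y ∈ r, Γ.Adj x.1 y.1) :
    ¬ StartsWith Γ (letterInv x) (r ++ s) := by
  rw [cancelFree_append] at h
  rw [startsWith_append]
  rintro (⟨r1, r2, rfl, -⟩ | ⟨-, h'⟩)
  · exact (hr (letterInv x) (by simp)).ne rfl
  · exact h.2.1.1 h'

lemma CancelFree.exists_not_adj {r s t : Word V} {x : V × Bool}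
    (h : CancelFree Γ (r ++ x :: (s ++ letterInv x :: t))) : ∃ y ∈ s, ¬ Γ.Adj x.1 y.1 := by
  rw [cancelFree_append] at h
  by_contra! hs
  exact h.2.1.1 ⟨s, t, rfl, hs⟩

/-- The `n`-fold concatenation of a word with itself. -/
def wordPow (w : Word V) : ℕ → Word V
  | 0 => []
  | n + 1 => w ++ wordPow w n

lemma wordPow_add (w : Word V) (m n : ℕ) : wordPow w (m + n) = wordPow w m ++ wordPow w n := by
  induction m with
  | zero => simp [wordPow]
  | succ m ih => rw [Nat.succ_add, wordPow, wordPow, ih, List.append_assoc]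

lemma wordPow_mul (w : Word V) (m n : ℕ) : wordPow w (m * n) = wordPow (wordPow w m) n := by
  induction n with
  | zero => simp [wordPow]
  | succ n ih => rw [Nat.mul_succ, Nat.add_comm, wordPow_add, ih, wordPow]

lemma StartsWith.of_wordPow {x : V × Bool} {w : Word V} {n : ℕ}
    (h : StartsWith Γ x (wordPow w n)) : StartsWith Γ x w := by
  induction n with
  | zero => exact (not_startsWith_nil x h).elim
  | succ n ih =>
    rw [wordPow, startsWith_append] at h
    exact h.elim id fun h => ih h.2

lemma EndsWith.of_wordPow {x : V × Bool} {w : Word V} {n : ℕ}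
    (h : EndsWith Γ x (wordPow w n)) : EndsWith Γ x w := by
  induction n with
  | zero => exact (not_startsWith_nil x h).elim
  | succ n ih =>
    rw [wordPow, endsWith_append] at h
    exact h.elim ih fun h => h.2

/-- A word without cancellation, even cyclically across its ends, has powers without
cancellation. -/
lemma CancelFree.wordPow {w : Word V} (h : CancelFree Γ w)
    (hc : ∀ x, EndsWith Γ x w → ¬ StartsWith Γ (letterInv x) w) (n : ℕ) :
    CancelFree Γ (wordPow w n) := by
  induction n with
  | zero => trivial
  | succ n ih =>
    exact cancelFree_append.2 ⟨h, ih, fun x hx hx' => hc x hx hx'.of_wordPow⟩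

end Words

/-! ### Evaluation of words -/

section Eval

variable {V : Type*} {Γ : SimpleGraph V}

@[simp] lemma eval_append (u v : Word V) : eval Γ (u ++ v) = eval Γ u * eval Γ v := by
  simp [eval, ← FreeGroup.mul_mk]

@[simp] lemma eval_nil : eval Γ [] = 1 := by
  rw [eval, ← FreeGroup.one_eq_mk, map_one]

lemma eval_cons (x : V × Bool) (w : Word V) : eval Γ (x :: w) = eval Γ [x] * eval Γ w :=
  eval_append [x] w

@[simp] lemma eval_invRev (u : Word V) : eval Γ (FreeGroup.invRev u) = (eval Γ u)⁻¹ := by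
  simp [eval, ← FreeGroup.inv_mk]

lemma eval_wordPow (w : Word V) (n : ℕ) : eval Γ (wordPow w n) = eval Γ w ^ n := by
  induction n with
  | zero => simp [wordPow]
  | succ n ih => rw [wordPow, eval_append, ih, pow_succ']

lemma eval_letterInv (x : V × Bool) : eval Γ [letterInv x] = (eval Γ [x])⁻¹ :=
  eval_invRev [x]

lemma eval_surjective : Function.Surjective (eval Γ) := by
  intro g
  obtain ⟨f, rfl⟩ := PresentedGroup.mk_surjective (relators Γ) g
  obtain ⟨w, rfl⟩ := Quot.exists_rep f
  exact ⟨w, rfl⟩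

lemma commute_eval_singleton {x y : V × Bool} (h : Γ.Adj x.1 y.1) :
    Commute (eval Γ [x]) (eval Γ [y]) := by
  have key : ∀ a b : V, Γ.Adj a b → Commute (eval Γ [(a, true)]) (eval Γ [(b, true)]) := by
    intro a b hab
    have h1 : PresentedGroup.mk (relators Γ)
        (FreeGroup.of a * FreeGroup.of b * (FreeGroup.of a)⁻¹ * (FreeGroup.of b)⁻¹) = 1 :=
      PresentedGroup.one_of_mem ⟨a, b, hab, rfl⟩
    rw [map_mul, map_mul, map_mul, map_inv, map_inv, mul_inv_eq_one, mul_inv_eq_iff_eq_mul] at h1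
    exact h1
  have hf : ∀ a : V, eval Γ [(a, false)] = (eval Γ [(a, true)])⁻¹ := fun a =>
    eval_letterInv (a, true)
  obtain ⟨a, ε⟩ := x
  obtain ⟨b, δ⟩ := y
  have := key a b h
  cases ε <;> cases δ <;> simp only [hf, Commute.inv_left_iff, Commute.inv_right_iff, this]

lemma commute_eval {x : V × Bool} {w : Word V} (h : ∀ y ∈ w, Γ.Adj x.1 y.1) :
    Commute (eval Γ [x]) (eval Γ w) := by
  induction w with
  | nil => simp
  | cons y w ih =>
    rw [eval_cons y w]
    exact (commute_eval_singleton (h y (by simp))).mul_right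
      (ih fun z hz => h z (by simp [hz]))

lemma eval_delete_left {x : V × Bool} {r s : Word V} (h : ∀ y ∈ r, Γ.Adj x.1 y.1) :
    eval Γ (r ++ x :: s) = eval Γ [x] * eval Γ (r ++ s) := by
  rw [eval_append, eval_append, eval_cons, ← mul_assoc, ← mul_assoc, (commute_eval h).eq]

lemma eval_delete_right {x : V × Bool} {r s : Word V} (h : ∀ y ∈ s, Γ.Adj x.1 y.1) :
    eval Γ (r ++ x :: s) = eval Γ (r ++ s) * eval Γ [x] := by
  rw [eval_append, eval_append, eval_cons, mul_assoc, (commute_eval h).eq]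

lemma StartsWith.exists_eval_eq {x : V × Bool} {w : Word V} (h : StartsWith Γ x w) :
    ∃ v : Word V, v.length + 1 = w.length ∧ eval Γ w = eval Γ [x] * eval Γ v := by
  obtain ⟨r, s, rfl, hr⟩ := h
  exact ⟨r ++ s, by simp; omega, eval_delete_left hr⟩

lemma EndsWith.exists_eval_eq {x : V × Bool} {w : Word V} (h : EndsWith Γ x w) :
    ∃ v : Word V, v.length + 1 = w.length ∧ eval Γ w = eval Γ v * eval Γ [x] := by
  obtain ⟨r, s, rfl, hs⟩ := h.exists_eq
  exact ⟨r ++ s, by simp; omega, eval_delete_right hs⟩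

lemma IsReduced.cancelFree {w : Word V} (h : IsReduced Γ w) : CancelFree Γ w := by
  have key : ∀ w : Word V, ¬ CancelFree Γ w → ∃ v, eval Γ v = eval Γ w ∧ v.length < w.length := by
    intro w
    induction w with
    | nil => exact fun h => (h trivial).elim
    | cons x w ih =>
      intro h
      by_cases hs : StartsWith Γ (letterInv x) w
      · obtain ⟨v, hv, he⟩ := hs.exists_eval_eq
        exact ⟨v, by rw [eval_cons, he, eval_letterInv]; simp, by simp; omega⟩
      · obtain ⟨v, hv, hl⟩ := ih fun h' => h ⟨hs, h'⟩
        exact ⟨x :: v, by rw [eval_cons, hv, ← eval_cons], by simpa using hl⟩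
  by_contra hw
  obtain ⟨v, hv, hl⟩ := key w hw
  exact absurd (h v hv) (by omega)

end Eval

/-! ### Projections to pairs of non-adjacent generators -/

section Projections

variable {V : Type*} (Γ : SimpleGraph V)

/-- Families of words indexed by the ordered pairs of non-adjacent (possibly equal) generators. -/
abbrev ProjFamily : Type _ :=
  {p : V × V // ¬ Γ.Adj p.1 p.2} → Word V

variable {Γ}

/-- The generator of the letter `x` is one of the two entries of the pair `p`. -/
def Touches (x : V × Bool) (p : V × V) : Prop :=
  x.1 = p.1 ∨ x.1 = p.2

variable (Γ) in
open Classical in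
/-- The projections of a word to all pairs `{a, b}` of non-adjacent generators, obtained by erasing
every letter on another generator. -/
noncomputable def proj (w : Word V) : ProjFamily Γ :=
  fun p => w.filter fun x => Touches x p.1

@[simp] lemma proj_nil : proj Γ [] = fun _ => [] := rfl

lemma proj_append (u v : Word V) (p : {p : V × V // ¬ Γ.Adj p.1 p.2}) :
    proj Γ (u ++ v) p = proj Γ u p ++ proj Γ v p :=
  List.filter_append ..

lemma proj_cons_of_touches {x : V × Bool} {p : {p : V × V // ¬ Γ.Adj p.1 p.2}}
    (h : Touches x p.1) (w : Word V) : proj Γ (x :: w) p = x :: proj Γ w p := by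
  simp [proj, h]

lemma proj_cons_of_not_touches {x : V × Bool} {p : {p : V × V // ¬ Γ.Adj p.1 p.2}}
    (h : ¬ Touches x p.1) (w : Word V) : proj Γ (x :: w) p = proj Γ w p := by
  simp [proj, h]

lemma proj_reverse (w : Word V) (p : {p : V × V // ¬ Γ.Adj p.1 p.2}) :
    proj Γ w.reverse p = (proj Γ w p).reverse :=
  List.filter_reverse ..

lemma not_touches_of_adj {x y : V × Bool} (h : Γ.Adj x.1 y.1)
    {p : {p : V × V // ¬ Γ.Adj p.1 p.2}} (hx : Touches x p.1) : ¬ Touches y p.1 := by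
  obtain ⟨⟨a, b⟩, hp⟩ := p
  rintro hy
  simp only [Touches] at hx hy hp
  rcases hx with hx | hx <;> rcases hy with hy | hy <;> rw [hx, hy] at h
  · exact h.ne rfl
  · exact hp h
  · exact hp h.symm
  · exact h.ne rfl

lemma proj_delete {x : V × Bool} {r s : Word V} (hr : ∀ y ∈ r, Γ.Adj x.1 y.1)
    (p : {p : V × V // ¬ Γ.Adj p.1 p.2}) :
    proj Γ (r ++ x :: s) p = proj Γ (x :: (r ++ s)) p := by
  by_cases hp : Touches x p.1
  · have : proj Γ r p = [] := by
      simp only [proj, List.filter_eq_nil_iff, decide_eq_true_eq]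
      exact fun y hy => not_touches_of_adj (hr y hy) hp
    rw [proj_append, this, proj_cons_of_touches hp, proj_cons_of_touches hp, proj_append, this,
      List.nil_append, List.nil_append]
  · rw [proj_append, proj_cons_of_not_touches hp, proj_cons_of_not_touches hp, proj_append]

/-- Which letters can be moved to the front is visible in the projections. -/
lemma startsWith_iff_proj {x : V × Bool} {w : Word V} :
    StartsWith Γ x w ↔ ∀ p, Touches x p.1 → (proj Γ w p).head? = some x := by
  constructor
  · rintro ⟨r, s, rfl, hr⟩ p hp
    rw [proj_delete hr, proj_cons_of_touches hp, List.head?_cons]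
  · intro h
    induction w with
    | nil => simpa using h ⟨(x.1, x.1), Γ.irrefl⟩ (Or.inl rfl)
    | cons y w ih =>
      rw [startsWith_cons]
      by_cases hxy : Γ.Adj x.1 y.1
      · refine Or.inr ⟨hxy, ih fun p hp => ?_⟩
        rw [← h p hp, proj_cons_of_not_touches (not_touches_of_adj hxy hp)]
      · have := h ⟨(x.1, y.1), hxy⟩ (Or.inl rfl)
        rw [proj_cons_of_touches (Or.inr rfl)] at this
        exact Or.inl (by simpa using this)

lemma StartsWith.of_proj_eq {x : V × Bool} {u v : Word V} (h : StartsWith Γ x u)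
    (huv : proj Γ u = proj Γ v) : StartsWith Γ x v := by
  rw [startsWith_iff_proj, ← huv]
  exact startsWith_iff_proj.1 h

lemma EndsWith.of_proj_eq {x : V × Bool} {u v : Word V} (h : EndsWith Γ x u)
    (huv : proj Γ u = proj Γ v) : EndsWith Γ x v :=
  StartsWith.of_proj_eq h (funext fun p => by rw [proj_reverse, proj_reverse, huv])

/-! ### The action of the group on projections of cancellation-free words -/

open Classical in
/-- Left multiplication by a letter on families of words: if the inverse letter is at the front of
every word indexed by a pair that involves its generator, it is cancelled, and otherwise the letter
is put in front of each of these words. -/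
noncomputable def push (x : V × Bool) (t : ProjFamily Γ) : ProjFamily Γ :=
  if ∀ p, Touches x p.1 → (t p).head? = some (letterInv x) then
    fun p => if Touches x p.1 then (t p).tail else t p
  else fun p => if Touches x p.1 then x :: t p else t p

lemma touches_letterInv {x : V × Bool} {p : V × V} :
    Touches (letterInv x) p ↔ Touches x p := Iff.rfl

lemma push_apply_of_not_touches {x : V × Bool} {t : ProjFamily Γ}
    {p : {p : V × V // ¬ Γ.Adj p.1 p.2}} (hp : ¬ Touches x p.1) : push x t p = t p := by
  unfold push
  split_ifs <;> simp [hp]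

lemma push_congr {x : V × Bool} {t t' : ProjFamily Γ} (h : ∀ p, Touches x p.1 → t p = t' p)
    {p : {p : V × V // ¬ Γ.Adj p.1 p.2}} (hp : Touches x p.1) : push x t p = push x t' p := by
  have hc : (∀ p, Touches x p.1 → (t p).head? = some (letterInv x)) ↔
      ∀ p, Touches x p.1 → (t' p).head? = some (letterInv x) :=
    forall_congr' fun p => forall_congr' fun hp => by rw [h p hp]
  by_cases ht : ∀ p, Touches x p.1 → (t p).head? = some (letterInv x)
  · rw [push, push, if_pos ht, if_pos (hc.1 ht)]
    simp [h p hp]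
  · rw [push, push, if_neg ht, if_neg (mt hc.2 ht)]
    simp [h p hp]

lemma push_comm {x y : V × Bool} (h : Γ.Adj x.1 y.1) (t : ProjFamily Γ) :
    push x (push y t) = push y (push x t) := by
  -- No pair is touched by both letters, so each of them only sees words the other leaves alone.
  funext p
  by_cases hx : Touches x p.1
  · rw [push_apply_of_not_touches (not_touches_of_adj h hx)]
    exact push_congr (fun q hq => push_apply_of_not_touches (not_touches_of_adj h hq)) hx
  · rw [push_apply_of_not_touches hx]
    by_cases hy : Touches y p.1
    · exact (push_congr (fun q hq =>
        push_apply_of_not_touches (not_touches_of_adj h.symm hq)) hy).symm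
    · rw [push_apply_of_not_touches hy, push_apply_of_not_touches hy,
        push_apply_of_not_touches hx]

lemma push_proj_of_not_startsWith {x : V × Bool} {w : Word V}
    (h : ¬ StartsWith Γ (letterInv x) w) : push x (proj Γ w) = proj Γ (x :: w) := by
  have h' := h
  rw [startsWith_iff_proj] at h'
  simp only [touches_letterInv] at h'
  rw [push, if_neg h']
  funext p
  split_ifs with hp
  · rw [proj_cons_of_touches hp]
  · rw [proj_cons_of_not_touches hp]

lemma push_proj_of_eq {x : V × Bool} {r s : Word V} (hr : ∀ y ∈ r, Γ.Adj x.1 y.1) :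
    push x (proj Γ (r ++ letterInv x :: s)) = proj Γ (r ++ s) := by
  have h : StartsWith Γ (letterInv x) (r ++ letterInv x :: s) := ⟨r, s, rfl, hr⟩
  rw [startsWith_iff_proj] at h
  simp only [touches_letterInv] at h
  rw [push, if_pos h]
  funext p
  rw [proj_delete (x := letterInv x) hr]
  split_ifs with hp
  · rw [proj_cons_of_touches (x := letterInv x) hp, List.tail_cons]
  · rw [proj_cons_of_not_touches (x := letterInv x) hp]

variable (Γ) in
/-- The families of projections of cancellation-free words. -/
abbrev ReducedFamily : Type _ :=
  {t : ProjFamily Γ // ∃ w, CancelFree Γ w ∧ proj Γ w = t}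

lemma push_mem (x : V × Bool) {t : ProjFamily Γ} (ht : ∃ w, CancelFree Γ w ∧ proj Γ w = t) :
    ∃ w, CancelFree Γ w ∧ proj Γ w = push x t := by
  obtain ⟨w, hw, rfl⟩ := ht
  by_cases h : StartsWith Γ (letterInv x) w
  · obtain ⟨r, s, rfl, hr⟩ := h
    rw [letterInv_fst] at hr
    exact ⟨r ++ s, hw.delete hr, (push_proj_of_eq hr).symm⟩
  · exact ⟨x :: w, ⟨h, hw⟩, (push_proj_of_not_startsWith h).symm⟩

lemma push_letterInv_push {x : V × Bool} {t : ProjFamily Γ}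
    (ht : ∃ w, CancelFree Γ w ∧ proj Γ w = t) : push (letterInv x) (push x t) = t := by
  obtain ⟨w, hw, rfl⟩ := ht
  by_cases h : StartsWith Γ (letterInv x) w
  · obtain ⟨r, s, rfl, hr⟩ := h
    rw [letterInv_fst] at hr
    rw [push_proj_of_eq hr, push_proj_of_not_startsWith (hw.not_startsWith_delete hr)]
    exact funext fun p => (proj_delete (x := letterInv x) hr p).symm
  · rw [push_proj_of_not_startsWith h]
    have := push_proj_of_eq (Γ := Γ) (x := letterInv x) (r := []) (s := w) (by simp)
    simpa using this

/-- The permutation of the reduced families given by a letter. -/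
noncomputable def pushPerm (x : V × Bool) : Equiv.Perm (ReducedFamily Γ) where
  toFun t := ⟨push x t.1, push_mem x t.2⟩
  invFun t := ⟨push (letterInv x) t.1, push_mem _ t.2⟩
  left_inv t := Subtype.ext (push_letterInv_push t.2)
  right_inv t := Subtype.ext (by
    simpa using push_letterInv_push (x := letterInv x) t.2)

lemma pushPerm_inv (x : V × Bool) :
    (pushPerm x : Equiv.Perm (ReducedFamily Γ))⁻¹ = pushPerm (letterInv x) := by
  ext t
  rfl

variable (Γ) in
/-- The action of the right-angled Artin group on the reduced families. -/
noncomputable def permHom : ArtinGroup Γ →* Equiv.Perm (ReducedFamily Γ) :=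
  PresentedGroup.toGroup (f := fun a => pushPerm (a, true)) (by
    rintro r ⟨a, b, hab, rfl⟩
    simp only [map_mul, map_inv, FreeGroup.lift_apply_of]
    rw [mul_inv_eq_one, mul_inv_eq_iff_eq_mul]
    ext1 t
    exact Subtype.ext (push_comm hab t.1))

lemma permHom_eval_singleton (x : V × Bool) : permHom Γ (eval Γ [x]) = pushPerm x := by
  have h : ∀ a : V, permHom Γ (eval Γ [(a, true)]) = pushPerm (a, true) := fun a =>
    PresentedGroup.toGroup.of _
  obtain ⟨a, _ | _⟩ := x
  · rw [show ((a, false) : V × Bool) = letterInv (a, true) from rfl, eval_letterInv, map_inv, h,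
      pushPerm_inv]
  · exact h a

lemma permHom_eval {w : Word V} (hw : CancelFree Γ w) :
    (permHom Γ (eval Γ w) ⟨proj Γ [], [], trivial, rfl⟩).1 = proj Γ w := by
  induction w with
  | nil => simp
  | cons x w ih =>
    rw [eval_cons, map_mul, permHom_eval_singleton, Equiv.Perm.mul_apply,
      ← push_proj_of_not_startsWith hw.1, ← ih hw.2]
    rfl

/-- Cancellation-free words that represent the same element have the same projections. -/
theorem CancelFree.proj_eq {u v : Word V} (hu : CancelFree Γ u) (hv : CancelFree Γ v)
    (h : eval Γ u = eval Γ v) : proj Γ u = proj Γ v := by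
  rw [← permHom_eval hu, h, permHom_eval hv]

end Projections

/-! ### Roots of cyclically reduced words -/

section Roots

variable {V : Type*} {Γ : SimpleGraph V}

lemma exists_minimal_length {P : Word V → Prop} (h : ∃ w, P w) :
    ∃ w, P w ∧ ∀ v, P v → w.length ≤ v.length := by
  obtain ⟨w, hw, hm⟩ := (measure (List.length (α := V × Bool))).wf.has_min {w | P w} h
  exact ⟨w, hw, fun v hv => not_lt.1 (hm v hv)⟩

lemma IsCyclicallyReduced.cancelFree {w : Word V} (hw : IsCyclicallyReduced Γ w) :
    CancelFree Γ w :=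
  (hw w (List.IsRotated.refl w)).cancelFree

lemma IsCyclicallyReduced.not_startsWith_of_endsWith {w : Word V}
    (hw : IsCyclicallyReduced Γ w) (x : V × Bool) (h : EndsWith Γ x w) :
    ¬ StartsWith Γ (letterInv x) w := by
  rintro ⟨r, s, rfl, hr⟩
  rw [letterInv_fst] at hr
  rw [endsWith_append, endsWith_cons] at h
  -- The letter `x` at the end lies in `s`, and rotating by `r` brings it close to `x⁻¹`.
  have hs : EndsWith Γ x s := by
    rcases h with (h | ⟨-, h⟩) | ⟨h, -⟩
    · exact h
    · exact (letterInv_ne x h).elim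
    · exact ((h (letterInv x) (by simp)).ne rfl).elim
  obtain ⟨s₁, s₂, rfl, hs₂⟩ := hs.exists_eq
  have hrot : (s₁ ++ x :: (s₂ ++ r ++ letterInv x :: [])) ~r
      (r ++ letterInv x :: (s₁ ++ x :: s₂)) := by
    have := List.isRotated_append (l := s₁ ++ x :: s₂) (l' := r ++ [letterInv x])
    simpa using this
  obtain ⟨y, hy, hxy⟩ := (hw _ hrot).cancelFree.exists_not_adj
  rw [List.mem_append] at hy
  exact hxy (hy.elim (hs₂ y) (hr y))

lemma IsCyclicallyReduced.cancelFree_wordPow {w : Word V} (hw : IsCyclicallyReduced Γ w) (n : ℕ) :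
    CancelFree Γ (wordPow w n) :=
  hw.cancelFree.wordPow hw.not_startsWith_of_endsWith n

/-- A word `h` of minimal length in its conjugacy class has cancellation-free powers. -/
lemma cancelFree_wordPow_of_minimal {h : Word V}
    (hmin : ∀ (v : Word V) (q : ArtinGroup Γ), eval Γ h = q * eval Γ v * q⁻¹ →
      h.length ≤ v.length) (n : ℕ) : CancelFree Γ (wordPow h n) := by
  have hred : IsReduced Γ h := fun v hv => hmin v 1 (by simp [hv])
  refine hred.cancelFree.wordPow ?_ n
  intro x hx hx'
  obtain ⟨r, s, rfl, hs⟩ := hx.exists_eq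
  -- Conjugating moves `x` to the front, where it cancels against `x⁻¹`.
  have hrs : StartsWith Γ (letterInv x) (r ++ s) := by
    rw [startsWith_append, startsWith_cons] at hx'
    rw [startsWith_append]
    rcases hx' with hx' | ⟨hr, hx' | hx'⟩
    · exact Or.inl hx'
    · exact (letterInv_ne x hx'.symm).elim
    · exact (hx'.1.ne rfl).elim
  obtain ⟨v, hv, he⟩ := hrs.exists_eval_eq
  have := hmin v (eval Γ [x])⁻¹ (by
    rw [eval_delete_right hs, he, eval_letterInv, inv_inv])
  simp only [List.length_append, List.length_cons] at this hv
  omega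

/-- A cyclically reduced word that represents a conjugate of an `n`-th power has the same
projections as the `n`-fold repetition of some word. For the proof, write the word as
`(p h p⁻¹) ^ n`, with `h` as short as possible, and then `p` as short as possible. Then
`p hⁿ p⁻¹` is cancellation-free, and as it has the projections of a cyclically reduced word, `p` is
empty. -/
theorem IsCyclicallyReduced.exists_proj_eq {w : Word V} (hw : IsCyclicallyReduced Γ w)
    {g : ArtinGroup Γ} {n : ℕ} (hn : 0 < n) (hwg : IsConj (eval Γ w) (g ^ n)) :
    ∃ h : Word V, proj Γ w = proj Γ (wordPow h n) := by
  obtain ⟨c, hc⟩ := isConj_iff.1 hwg.symm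
  obtain ⟨h, ⟨q, hq⟩, hmin⟩ := exists_minimal_length
    (P := fun h : Word V => ∃ q : ArtinGroup Γ, c * g * c⁻¹ = q * eval Γ h * q⁻¹) (by
      obtain ⟨h, rfl⟩ := eval_surjective g
      exact ⟨h, c, rfl⟩)
  obtain ⟨p, ⟨h, hlen, hp⟩, hpmin⟩ := exists_minimal_length
    (P := fun p : Word V => ∃ h' : Word V, h'.length = h.length ∧
      c * g * c⁻¹ = eval Γ p * eval Γ h' * (eval Γ p)⁻¹) (by
      obtain ⟨p, rfl⟩ := eval_surjective q
      exact ⟨p, h, rfl, hq⟩)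
  simp only [← hlen] at hmin hpmin
  have hpred : IsReduced Γ p := fun v hv => hpmin v ⟨h, rfl, by rw [hv, hp]⟩
  have hpred' : IsReduced Γ (FreeGroup.invRev p) := by
    intro v hv
    have := hpred (FreeGroup.invRev v) (by simp [hv])
    simpa using this
  have hh : CancelFree Γ (wordPow h n) := by
    refine cancelFree_wordPow_of_minimal (fun v q hq => hmin v ⟨eval Γ p * q, ?_⟩) n
    rw [hp, hq]
    group
  -- In each of the three cases where a letter of `p` cancels, `p` can be shortened.
  have hfree : CancelFree Γ (p ++ (wordPow h n ++ FreeGroup.invRev p)) := by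
    refine cancelFree_append.2 ⟨hpred.cancelFree,
      cancelFree_append.2 ⟨hh, hpred'.cancelFree, ?_⟩, ?_⟩
    · intro x hx hx'
      obtain ⟨h', hl, he⟩ := hx.of_wordPow.exists_eval_eq
      obtain ⟨p', hpl, hpe⟩ := (startsWith_invRev.1 hx').exists_eval_eq
      have := hpmin p' ⟨x :: h', by simp [hl], by
        rw [hp, he, hpe, eval_cons x h']
        group⟩
      omega
    · intro x hx hx'
      obtain ⟨p', hpl, hpe⟩ := hx.exists_eval_eq
      rw [startsWith_append] at hx'
      rcases hx' with hx' | ⟨hx', -⟩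
      · obtain ⟨h', hl, he⟩ := hx'.of_wordPow.exists_eval_eq
        have := hpmin p' ⟨h' ++ [letterInv x], by simp [hl], by
          rw [hp, he, hpe, eval_append, eval_letterInv]
          group⟩
        omega
      · obtain ⟨n, rfl⟩ := Nat.exists_eq_add_of_lt hn
        have hcomm : Commute (eval Γ [x]) (eval Γ h) := by
          refine commute_eval fun y hy => hx' y ?_
          simp [wordPow, hy]
        have := hpmin p' ⟨h, rfl, by
          rw [hp, hpe, mul_assoc _ _ (eval Γ h), hcomm.eq]
          group⟩
        omega
  have heval : eval Γ w = eval Γ (p ++ (wordPow h n ++ FreeGroup.invRev p)) := by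
    rw [eval_append, eval_append, eval_wordPow, eval_invRev, ← mul_assoc, ← conj_pow, ← hp,
      conj_pow, hc]
  have hproj := hw.cancelFree.proj_eq hfree heval
  rcases p with _ | ⟨x, p⟩
  · exact ⟨h, by simpa [FreeGroup.invRev] using hproj⟩
  · have h1 : StartsWith Γ x (x :: p) := startsWith_cons.2 (Or.inl rfl)
    have hs : StartsWith Γ x w :=
      StartsWith.of_proj_eq (startsWith_append.2 (Or.inl h1)) hproj.symm
    have he : EndsWith Γ (letterInv x) w := by
      refine EndsWith.of_proj_eq ?_ hproj.symm
      exact endsWith_append.2 (Or.inl (endsWith_append.2 (Or.inl (endsWith_invRev.2 h1))))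
    exact (hw.not_startsWith_of_endsWith _ he (by simpa using hs)).elim

end Roots

/-! ### Reflections of infinite sequences of letters -/

section Sequences

variable {V : Type*} [DecidableEq V]

/-- The number of letters on the generator `a` among the first `t` terms of the sequence `W`. -/
def genCount (W : ℕ → V × Bool) (a : V) (t : ℕ) : ℕ :=
  Nat.count (fun i => (W i).1 = a) t

lemma genCount_succ (W : ℕ → V × Bool) (a : V) (t : ℕ) :
    genCount W a (t + 1) = genCount W a t + if (W t).1 = a then 1 else 0 :=
  Nat.count_succ ..

lemma genCount_mono (W : ℕ → V × Bool) (a : V) : Monotone (genCount W a) :=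
  Nat.count_monotone _

lemma genCount_lt {W : ℕ → V × Bool} {x y : ℕ} (h : x < y) :
    genCount W (W x).1 x < genCount W (W x).1 y := by
  have h1 := genCount_succ W (W x).1 x
  have h2 : genCount W (W x).1 (x + 1) ≤ genCount W (W x).1 y := genCount_mono W _ h
  rw [if_pos rfl] at h1
  omega

lemma exists_genCount_eq {W : ℕ → V × Bool} {a : V} {p k i : ℕ} (h1 : genCount W a p ≤ i)
    (h2 : i < genCount W a (p + k)) :
    ∃ y, p ≤ y ∧ y < p + k ∧ (W y).1 = a ∧ genCount W a y = i := by
  induction k with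
  | zero => simp at h2; omega
  | succ k ih =>
    by_cases h : i < genCount W a (p + k)
    · obtain ⟨y, hy1, hy2, hy⟩ := ih h
      exact ⟨y, hy1, by omega, hy⟩
    · rw [← Nat.add_assoc, genCount_succ] at h2
      by_cases hk : (W (p + k)).1 = a
      · rw [if_pos hk] at h2
        exact ⟨p + k, by omega, by omega, hk, by omega⟩
      · rw [if_neg hk] at h2
        omega

/-- The data of an infinite sequence of letters without cancellation, together with an automorphism
of its heap: the occurrences of non-adjacent generators come in the same order after the `i`-th
occurrence of every generator `a` has been replaced by occurrence number `i + m a`. -/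
structure IsHeapShift (Γ : SimpleGraph V) (W : ℕ → V × Bool) (m : V → ℕ) : Prop where
  exists_genCount : ∀ a b, ¬ Γ.Adj a b → ∀ t, ∃ t',
    genCount W a t' = genCount W a t + m a ∧ genCount W b t' = genCount W b t + m b
  letter_eq : ∀ x y, (W y).1 = (W x).1 →
    genCount W (W x).1 y = genCount W (W x).1 x + m (W x).1 → W y = W x
  exists_not_adj : ∀ x y, x < y → W y = letterInv (W x) →
    ∃ z, x < z ∧ z < y ∧ ¬ Γ.Adj (W x).1 (W z).1
  unbounded : ∀ x c, ∃ t, c < genCount W (W x).1 t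
  pos : ∀ x, 0 < m (W x).1

/-- The position `y` is the image of the position `x` under the `j`-th power of the heap
automorphism. -/
def ShiftRel (W : ℕ → V × Bool) (m : V → ℕ) (j x y : ℕ) : Prop :=
  (W y).1 = (W x).1 ∧ genCount W (W x).1 y = genCount W (W x).1 x + j * m (W x).1

variable {Γ : SimpleGraph V} {W : ℕ → V × Bool} {m : V → ℕ}

lemma IsHeapShift.exists_genCount_mul (hW : IsHeapShift Γ W m) {a b : V} (hab : ¬ Γ.Adj a b)
    (j t : ℕ) : ∃ t', genCount W a t' = genCount W a t + j * m a ∧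
      genCount W b t' = genCount W b t + j * m b := by
  induction j with
  | zero => exact ⟨t, by simp⟩
  | succ j ih =>
    obtain ⟨s, hs1, hs2⟩ := ih
    obtain ⟨t', h1, h2⟩ := hW.exists_genCount a b hab s
    exact ⟨t', by rw [h1, hs1]; ring, by rw [h2, hs2]; ring⟩

lemma IsHeapShift.exists_shiftRel (hW : IsHeapShift Γ W m) (j x : ℕ) :
    ∃ y, ShiftRel W m j x y := by
  obtain ⟨t, ht⟩ := hW.unbounded x (genCount W (W x).1 x + j * m (W x).1)
  obtain ⟨y, -, -, hy⟩ := exists_genCount_eq (p := 0) (k := t)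
    (by simp [genCount]) (by simpa using ht)
  exact ⟨y, hy⟩

lemma IsHeapShift.letter_eq_of_shiftRel (hW : IsHeapShift Γ W m) {j x y : ℕ}
    (h : ShiftRel W m j x y) : W y = W x := by
  induction j generalizing y with
  | zero =>
    obtain ⟨h1, h2⟩ := h
    rw [Nat.zero_mul, Nat.add_zero] at h2
    have hxy : x = y := by
      rcases lt_trichotomy x y with h | h | h
      · exact absurd (genCount_lt (W := W) h) (by omega)
      · exact h
      · have := genCount_lt (W := W) h
        rw [h1] at this
        omega
    rw [hxy]
  | succ j ih =>
    obtain ⟨z, hz⟩ := hW.exists_shiftRel j x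
    rw [← ih hz]
    refine hW.letter_eq z y (h.1.trans hz.1.symm) ?_
    rw [hz.1, h.2, hz.2]
    ring

lemma IsHeapShift.lt_of_shiftRel (hW : IsHeapShift Γ W m) {j x y x' y' : ℕ}
    (hx : ShiftRel W m j x x') (hy : ShiftRel W m j y y') (hadj : ¬ Γ.Adj (W x).1 (W y).1)
    (h : x < y) : x' < y' := by
  obtain ⟨t, ht1, ht2⟩ := hW.exists_genCount_mul hadj j y
  have h1 : x' < t := by
    by_contra! hle
    have h1 := genCount_lt (W := W) h
    have h2 := genCount_mono W (W x).1 hle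
    have h3 := hx.2
    omega
  have h2 : t ≤ y' := by
    by_contra! hlt
    have h1 := genCount_lt (W := W) hlt
    rw [hy.1] at h1
    have h3 := hy.2
    omega
  omega

variable {p q k : ℕ}

lemma genCount_add_genCount (hpq : ∀ x z, p ≤ x → q ≤ z → x + z + 1 = p + q + k →
      W x = letterInv (W z)) (a : V) {x z : ℕ} (hx : p ≤ x) (hz : q ≤ z)
    (h : x + z = p + q + k) :
    genCount W a x + genCount W a z = genCount W a p + genCount W a (q + k) := by
  induction x, hx using Nat.le_induction generalizing z with
  | base => rw [show z = q + k by omega]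
  | succ x hx ih =>
    have h1 := ih (z := z + 1) (by omega) (by omega)
    have h2 := hpq x z hx hz (by omega)
    have h3 := genCount_succ W a x
    have h4 := genCount_succ W a z
    have h5 : (W x).1 = (W z).1 := by rw [h2, letterInv_fst]
    rw [h5] at h3
    omega

lemma ShiftRel.symm_of_reflection (hpq : ∀ x z, p ≤ x → q ≤ z → x + z + 1 = p + q + k →
      W x = letterInv (W z)) {j x x' y y' : ℕ} (hx : p ≤ x) (hx' : q ≤ x')
    (hxx' : x + x' + 1 = p + q + k) (hy : p ≤ y) (hy' : q ≤ y')
    (hyy' : y + y' + 1 = p + q + k) (h : ShiftRel W m j x' y) : ShiftRel W m j y' x := by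
  have e1 : (W x).1 = (W x').1 := by rw [hpq x x' hx hx' hxx', letterInv_fst]
  have e2 : (W y).1 = (W y').1 := by rw [hpq y y' hy hy' hyy', letterInv_fst]
  obtain ⟨h1, h2⟩ := h
  have e3 : (W y').1 = (W x').1 := e2.symm.trans h1
  refine ⟨by rw [e1, e3], ?_⟩
  rw [e3]
  have h3 := genCount_add_genCount hpq (W x').1 hx (z := x' + 1) (by omega) (by omega)
  have h4 := genCount_add_genCount hpq (W x').1 hy (z := y' + 1) (by omega) (by omega)
  rw [genCount_succ, if_pos rfl] at h3
  rw [genCount_succ, if_pos e3] at h4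
  omega

/-- Let the block `[p, p + k)` be the formal inverse of the block `[q, q + k)`. Then no shift of the
second block meets the first one in the heap. If it did, reversal followed by the shift would
restrict to an involution of the intersection which reverses order and inverts letters. It has no
fixed points, and as the sequence has no cancellation, between any two letters interchanged by it
there are two more such letters. -/
lemma IsHeapShift.not_shiftRel_of_lt (hW : IsHeapShift Γ W m)
    (hpq : ∀ x z, p ≤ x → q ≤ z → x + z + 1 = p + q + k → W x = letterInv (W z))
    {j x x' y : ℕ} (hx : p ≤ x) (hxy : x < y) (hy : y < p + k)
    (hxx' : x + x' + 1 = p + q + k) : ¬ ShiftRel W m j x' y := by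
  induction hd : y - x using Nat.strong_induction_on generalizing x x' y with
  | _ d ih =>
  intro h
  have hlet : W x = letterInv (W x') := hpq x x' hx (by omega) hxx'
  have hlet' : W y = W x' := hW.letter_eq_of_shiftRel h
  obtain ⟨z, hxz, hzy, hz⟩ := hW.exists_not_adj x y hxy (by rw [hlet, hlet', letterInv_letterInv])
  obtain ⟨z', hzz'⟩ : ∃ z', z + z' + 1 = p + q + k := ⟨p + q + k - 1 - z, by omega⟩
  obtain ⟨y', hyy'⟩ : ∃ y', y + y' + 1 = p + q + k := ⟨p + q + k - 1 - y, by omega⟩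
  have hletz : W z = letterInv (W z') := hpq z z' (by omega) (by omega) hzz'
  have hlety : W y = letterInv (W y') := hpq y y' (by omega) (by omega) hyy'
  have h' : ShiftRel W m j y' x :=
    ShiftRel.symm_of_reflection hpq hx (by omega) hxx' (by omega) (by omega) hyy' h
  obtain ⟨v, hv⟩ := hW.exists_shiftRel j z'
  have ez : (W z').1 = (W z).1 := by rw [hletz, letterInv_fst]
  have ex : (W x').1 = (W x).1 := by rw [hlet, letterInv_fst]
  have ey : (W y').1 = (W x).1 := by rw [← ex, ← hlet', hlety, letterInv_fst]
  have hvy : v < y := hW.lt_of_shiftRel hv h (by rwa [ez, ex, Γ.adj_comm]) (by omega)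
  have hxv : x < v := hW.lt_of_shiftRel h' hv (by rwa [ez, ey]) (by omega)
  rcases lt_trichotomy z v with hlt | heq | hgt
  · exact ih (v - z) (by omega) (by omega) hlt (by omega) hzz' rfl hv
  · have := hW.letter_eq_of_shiftRel hv
    rw [← heq, hletz] at this
    exact letterInv_ne _ this
  · obtain ⟨v', hvv'⟩ : ∃ v', v + v' + 1 = p + q + k := ⟨p + q + k - 1 - v, by omega⟩
    have hv' : ShiftRel W m j v' z :=
      ShiftRel.symm_of_reflection hpq (by omega) (by omega) hzz' (by omega) (by omega) hvv' hv
    exact ih (z - v) (by omega) (by omega) hgt (by omega) hvv' rfl hv'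

lemma IsHeapShift.not_shiftRel (hW : IsHeapShift Γ W m)
    (hpq : ∀ x z, p ≤ x → q ≤ z → x + z + 1 = p + q + k → W x = letterInv (W z))
    {j x x' y : ℕ} (hx : p ≤ x) (hx' : q ≤ x') (hy : p ≤ y) (hyk : y < p + k)
    (hxx' : x + x' + 1 = p + q + k) : ¬ ShiftRel W m j x' y := by
  intro h
  rcases lt_trichotomy x y with hlt | rfl | hgt
  · exact hW.not_shiftRel_of_lt hpq hx hlt hyk hxx' h
  · have := hW.letter_eq_of_shiftRel h
    rw [hpq x x' hx hx' hxx'] at this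
    exact letterInv_ne _ this
  · obtain ⟨y', hyy'⟩ : ∃ y', y + y' + 1 = p + q + k := ⟨p + q + k - 1 - y, by omega⟩
    exact hW.not_shiftRel_of_lt hpq hy hgt (by omega) hyy'
      (ShiftRel.symm_of_reflection hpq hx hx' hxx' hy (by omega) hyy' h)

/-- Since all shifts of the block `[q, q + k)` avoid the block `[p, p + k)` inverse to it, the
occurrences of `a` in either of them take up at most half a period. -/
lemma IsHeapShift.two_mul_genCount_le (hW : IsHeapShift Γ W m)
    (hpq : ∀ x z, p ≤ x → q ≤ z → x + z + 1 = p + q + k → W x = letterInv (W z))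
    (hqp : q ≤ p) (a : V) :
    2 * (genCount W a (p + k) - genCount W a p) ≤ m a := by
  by_contra! hlt
  have hl : genCount W a (p + k) - genCount W a (p) =
      genCount W a (q + k) - genCount W a q := by
    have := genCount_add_genCount hpq a (x := p + k) (z := q) (by omega) le_rfl (by omega)
    omega
  have hs : genCount W a q ≤ genCount W a p := genCount_mono W a hqp
  set s := genCount W a p
  set s' := genCount W a q
  set l := genCount W a (p + k) - s with hl'
  have key : ∀ i j, s' ≤ i → i < s' + l → s ≤ i + j * m a → i + j * m a < s + l → False := by
    intro i j h1 h2 h3 h4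
    obtain ⟨y, hy1, hy2, hya, hyc⟩ := exists_genCount_eq (W := W) (k := k) h3 (by omega)
    obtain ⟨x', hx1, hx2, hxa, hxc⟩ := exists_genCount_eq (W := W) (k := k) h1 (by omega)
    refine hW.not_shiftRel hpq (x := p + q + k - 1 - x') (x' := x') (j := j) (by omega) hx1 hy1 hy2
      (by omega) ⟨by rw [hya, hxa], ?_⟩
    rw [hxa, hyc, hxc]
  have hm : 0 < m a := by
    obtain ⟨y, -, -, hy, -⟩ := exists_genCount_eq (W := W) (a := a) (p := p) (k := k) (i := s)
      le_rfl (by omega)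
    rw [← hy]
    exact hW.pos y
  -- Write `s - s' = j * m a + r`. The shift by `j` starts `r` places before the first block, and
  -- the next one `m a - r` places after its start, so that one of the two must meet it.
  have hr := Nat.mod_lt (s - s') hm
  have hdiv := Nat.div_add_mod' (s - s') (m a)
  set r := (s - s') % m a
  set j := (s - s') / m a
  by_cases hrl : r < l
  · exact key (s' + r) j (by omega) (by omega) (by omega) (by omega)
  · have hj : (j + 1) * m a = j * m a + m a := by ring
    exact key s' (j + 1) (by omega) (by omega) (by omega) (by omega)

end Sequences

/-! ### The periodic sequence of a cyclically reduced word -/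

section Periodic

variable {V : Type*}

/-- The first `t` terms of a sequence of letters, as a word. -/
def initialWord (W : ℕ → V × Bool) (t : ℕ) : Word V :=
  (List.range t).map W

lemma initialWord_add (W : ℕ → V × Bool) (s t : ℕ) :
    initialWord W (s + t) = initialWord W s ++ initialWord (fun i => W (s + i)) t := by
  simp [initialWord, List.range_add, Function.comp_def]

lemma initialWord_succ (W : ℕ → V × Bool) (t : ℕ) :
    initialWord W (t + 1) = initialWord W t ++ [W t] := by
  simp [initialWord, List.range_succ]

@[simp] lemma length_initialWord (W : ℕ → V × Bool) (t : ℕ) : (initialWord W t).length = t := by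
  simp [initialWord]

lemma initialWord_prefix (W : ℕ → V × Bool) {s t : ℕ} (h : s ≤ t) :
    initialWord W s <+: initialWord W t := by
  obtain ⟨d, rfl⟩ := Nat.exists_eq_add_of_le h
  exact ⟨_, (initialWord_add W s d).symm⟩

lemma CancelFree.exists_not_adj_of_initialWord {Γ : SimpleGraph V} {W : ℕ → V × Bool}
    (h : ∀ t, CancelFree Γ (initialWord W t)) {x y : ℕ} (hxy : x < y)
    (hW : W y = letterInv (W x)) : ∃ z, x < z ∧ z < y ∧ ¬ Γ.Adj (W x).1 (W z).1 := by
  obtain ⟨d, rfl⟩ := Nat.exists_eq_add_of_lt hxy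
  have h1 := h (x + d + 1 + 1)
  have h2 : initialWord W (x + d + 1 + 1) = initialWord W x ++ W x ::
      (initialWord (fun i => W (x + 1 + i)) d ++ letterInv (W x) :: []) := by
    rw [initialWord_succ, show x + d + 1 = x + 1 + d by omega, initialWord_add W (x + 1),
      initialWord_succ W x, ← hW, show x + d + 1 = x + 1 + d by omega]
    simp
  rw [h2] at h1
  obtain ⟨c, hc, hadj⟩ := h1.exists_not_adj
  obtain ⟨i, hi, rfl⟩ := List.mem_map.1 hc
  rw [List.mem_range] at hi
  exact ⟨x + 1 + i, by omega, by omega, hadj⟩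

/-- The infinite repetition of a non-empty word. -/
def periodicSeq (w : Word V) (hw : 0 < w.length) (i : ℕ) : V × Bool :=
  w[i % w.length]'(Nat.mod_lt i hw)

variable {w : Word V} {hw : 0 < w.length}

lemma periodicSeq_add_mul (i j : ℕ) :
    periodicSeq w hw (i + j * w.length) = periodicSeq w hw i := by
  simp [periodicSeq]

lemma initialWord_periodicSeq (N : ℕ) :
    initialWord (periodicSeq w hw) (N * w.length) = wordPow w N := by
  induction N with
  | zero => simp [initialWord, wordPow]
  | succ N ih =>
    have h1 : initialWord (periodicSeq w hw) w.length = w := by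
      refine List.ext_getElem (by simp) fun i h1 h2 => ?_
      simp [initialWord, periodicSeq, Nat.mod_eq_of_lt h2]
    have h2 : (fun i => periodicSeq w hw (w.length + i)) = periodicSeq w hw := by
      funext i
      simpa [Nat.add_comm] using periodicSeq_add_mul (hw := hw) i 1
    rw [Nat.succ_mul, Nat.add_comm, initialWord_add, h1, h2, ih, wordPow]

lemma IsCyclicSubword.exists_initialWord_eq {u : Word V} (h : IsCyclicSubword u w) :
    ∃ p, initialWord (fun i => periodicSeq w hw (p + i)) u.length = u := by
  obtain ⟨w', hrot, s, t, rfl⟩ := h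
  obtain ⟨r, hr⟩ := hrot.symm
  refine ⟨s.length + r, List.ext_getElem (by simp) fun i h1 h2 => ?_⟩
  have hlen : s.length + i < (w.rotate r).length := by
    rw [hr]; simp; omega
  have h3 : (w.rotate r)[s.length + i] = u[i] := by
    simp [hr, h2]
  rw [← h3, List.getElem_rotate]
  simp [initialWord, periodicSeq, Nat.add_right_comm]

lemma proj_wordPow {Γ : SimpleGraph V} (w : Word V) (n : ℕ)
    (p : {p : V × V // ¬ Γ.Adj p.1 p.2}) : proj Γ (wordPow w n) p = wordPow (proj Γ w p) n := by
  induction n with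
  | zero => simp [wordPow]
  | succ n ih => rw [wordPow, proj_append, ih, wordPow]

/-- If the projections of `w` are those of `hⁿ`, then prefixing `h` turns a projection of an
initial word of the repetition of `w` into one of another initial word. -/
lemma append_proj_prefix {Γ : SimpleGraph V} {h : Word V} {n : ℕ} (hn : 0 < n)
    (hproj : proj Γ w = proj Γ (wordPow h n)) {t T : ℕ} (hT : t < T)
    (p : {p : V × V // ¬ Γ.Adj p.1 p.2}) :
    proj Γ h p ++ proj Γ (initialWord (periodicSeq w hw) t) p <+:
      proj Γ (initialWord (periodicSeq w hw) (T * w.length)) p := by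
  have hpre : ∀ {u v : Word V}, u <+: v → proj Γ u p <+: proj Γ v p := by
    rintro u _ ⟨s, rfl⟩
    exact ⟨proj Γ s p, (proj_append u s p).symm⟩
  have h1 : proj Γ (initialWord (periodicSeq w hw) t) p <+: wordPow (proj Γ h p) (n * t) := by
    have := hpre (initialWord_prefix (periodicSeq w hw) (Nat.le_mul_of_pos_right t hw))
    rwa [initialWord_periodicSeq, proj_wordPow, hproj, proj_wordPow, ← wordPow_mul] at this
  have h2 : wordPow (proj Γ h p) (n * t + 1) <+:
      proj Γ (initialWord (periodicSeq w hw) (T * w.length)) p := by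
    rw [initialWord_periodicSeq, proj_wordPow, hproj, proj_wordPow, ← wordPow_mul]
    have hle : n * t + 1 ≤ n * T := by
      have := Nat.mul_le_mul_left n (Nat.succ_le_of_lt hT)
      rw [Nat.mul_succ] at this
      omega
    obtain ⟨d, hd⟩ := Nat.exists_eq_add_of_le hle
    rw [hd, wordPow_add _ (n * t + 1)]
    exact List.prefix_append _ _
  refine List.IsPrefix.trans ?_ h2
  rw [wordPow]
  exact (List.prefix_append_right_inj _).2 h1

lemma exists_initialWord_proj_eq {Γ : SimpleGraph V} {W : ℕ → V × Bool} {T : ℕ} {v : Word V}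
    {p : {p : V × V // ¬ Γ.Adj p.1 p.2}} (h : v <+: proj Γ (initialWord W T) p) :
    ∃ t, proj Γ (initialWord W t) p = v := by
  induction T with
  | zero => exact ⟨0, (List.prefix_nil.1 h).symm⟩
  | succ T ih =>
    by_cases hv : v = proj Γ (initialWord W (T + 1)) p
    · exact ⟨T + 1, hv.symm⟩
    · refine ih ?_
      rw [initialWord_succ, proj_append] at h hv
      by_cases hT : Touches (W T) p.1
      · rw [proj_cons_of_touches hT, proj_nil] at h hv
        exact (List.prefix_concat_iff.1 h).resolve_left (by simpa using hv)
      · rwa [proj_cons_of_not_touches hT, proj_nil, List.append_nil] at h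

variable [DecidableEq V]

/-- The number of letters of a word on the generator `a`. -/
def wordCount (a : V) (w : Word V) : ℕ :=
  w.countP fun x => x.1 = a

lemma wordCount_append (a : V) (u v : Word V) :
    wordCount a (u ++ v) = wordCount a u + wordCount a v :=
  List.countP_append ..

lemma wordCount_wordPow (a : V) (w : Word V) (n : ℕ) :
    wordCount a (wordPow w n) = n * wordCount a w := by
  induction n with
  | zero => simp [wordPow, wordCount]
  | succ n ih => rw [wordPow, wordCount_append, ih]; ring

lemma wordCount_initialWord (W : ℕ → V × Bool) (a : V) (t : ℕ) :
    wordCount a (initialWord W t) = genCount W a t := by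
  induction t with
  | zero => simp [wordCount, initialWord, genCount]
  | succ t ih =>
    rw [initialWord_succ, wordCount_append, ih, genCount_succ]
    by_cases h : (W t).1 = a <;> simp [wordCount, h]

lemma wordCount_proj {Γ : SimpleGraph V} {a : V} (w : Word V) {p : {p : V × V // ¬ Γ.Adj p.1 p.2}}
    (h : a = p.1.1 ∨ a = p.1.2) : wordCount a (proj Γ w p) = wordCount a w := by
  rw [wordCount, wordCount, proj, List.countP_filter]
  refine List.countP_congr fun x _ => ?_
  simp only [Bool.and_eq_true, decide_eq_true_eq, and_iff_left_iff_imp]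
  rintro rfl
  exact h

lemma length_proj_self {Γ : SimpleGraph V} (a : V) (w : Word V) :
    (proj Γ w ⟨(a, a), Γ.irrefl⟩).length = wordCount a w := by
  rw [wordCount, List.countP_eq_length_filter, proj]
  congr 1
  refine List.filter_congr fun x _ => ?_
  simp [Touches]

lemma length_eq_sum_wordCount [Fintype V] (w : Word V) : w.length = ∑ a, wordCount a w := by
  induction w with
  | nil => simp [wordCount]
  | cons x w ih =>
    simp only [wordCount, List.countP_cons, List.length_cons, Finset.sum_add_distrib] at ih ⊢
    simp [ih]

lemma isHeapShift_periodicSeq {Γ : SimpleGraph V} (hc : IsCyclicallyReduced Γ w)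
    {h : Word V} {n : ℕ} (hn : 0 < n) (hproj : proj Γ w = proj Γ (wordPow h n)) :
    IsHeapShift Γ (periodicSeq w hw) fun a => wordCount a h where
  exists_genCount a b hab t := by
    obtain ⟨t', ht'⟩ := exists_initialWord_proj_eq
      (append_proj_prefix (hw := hw) hn hproj t.lt_succ_self ⟨(a, b), hab⟩)
    have key : ∀ c, (c = a ∨ c = b) → genCount (periodicSeq w hw) c t' =
        genCount (periodicSeq w hw) c t + wordCount c h := by
      intro c hc
      have := congrArg (wordCount c) ht'
      rw [wordCount_append, wordCount_proj _ hc, wordCount_proj _ hc, wordCount_proj _ hc,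
        wordCount_initialWord, wordCount_initialWord] at this
      omega
    exact ⟨t', key a (Or.inl rfl), key b (Or.inr rfl)⟩
  letter_eq x y hxy hcount := by
    set W := periodicSeq w hw
    let p : {p : V × V // ¬ Γ.Adj p.1 p.2} := ⟨((W x).1, (W x).1), Γ.irrefl⟩
    have h1 := append_proj_prefix (hw := hw) hn hproj (t := x + 1) (T := x + y + 2)
      (by omega) p
    have h2 : proj Γ (initialWord W (y + 1)) p <+:
        proj Γ (initialWord W ((x + y + 2) * w.length)) p := by
      obtain ⟨s, hs⟩ := initialWord_prefix W (s := y + 1)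
        (t := (x + y + 2) * w.length)
        (le_trans (by omega) (Nat.le_mul_of_pos_right _ hw))
      exact ⟨proj Γ s p, by rw [← proj_append, hs]⟩
    have hl : (proj Γ h p ++ proj Γ (initialWord W (x + 1)) p).length =
        (proj Γ (initialWord W (y + 1)) p).length := by
      rw [List.length_append, length_proj_self, length_proj_self, length_proj_self,
        wordCount_initialWord, wordCount_initialWord, genCount_succ, genCount_succ, if_pos hxy,
        if_pos rfl]
      omega
    have h3 := (List.prefix_of_prefix_length_le h1 h2 hl.le).eq_of_length hl
    have hx : Touches (W x) p.1 := Or.inl rfl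
    have hy : Touches (W y) p.1 := Or.inl hxy
    rw [initialWord_succ, initialWord_succ, proj_append, proj_append, proj_cons_of_touches hx,
      proj_cons_of_touches hy, ← List.append_assoc] at h3
    simpa using (congrArg List.getLast? h3).symm
  exists_not_adj x y hxy hW := by
    refine CancelFree.exists_not_adj_of_initialWord (fun t => ?_) hxy hW
    obtain ⟨s, hs⟩ := initialWord_prefix (periodicSeq w hw) (Nat.le_mul_of_pos_right t hw)
    have := hc.cancelFree_wordPow t
    rw [← initialWord_periodicSeq (hw := hw), ← hs, cancelFree_append] at this
    exact this.1
  unbounded x c := by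
    refine ⟨(c + 1) * w.length, ?_⟩
    rw [← wordCount_initialWord, initialWord_periodicSeq, wordCount_wordPow]
    have : 0 < wordCount (periodicSeq w hw x).1 w :=
      List.countP_pos_iff.2 ⟨_, List.getElem_mem (Nat.mod_lt x hw), by simp [periodicSeq]⟩
    nlinarith
  pos x := by
    have h1 : 0 < wordCount (periodicSeq w hw x).1 w :=
      List.countP_pos_iff.2 ⟨_, List.getElem_mem (Nat.mod_lt x hw), by simp [periodicSeq]⟩
    rw [← wordCount_proj (Γ := Γ) (p := ⟨(_, _), Γ.irrefl⟩) w (Or.inl rfl), hproj,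
      wordCount_proj _ (Or.inl rfl), wordCount_wordPow] at h1
    exact Nat.pos_of_mul_pos_left h1

/-- Every generator satisfies the claimed inequality separately. -/
theorem IsCyclicallyReduced.wordCount_le {Γ : SimpleGraph V} (hc : IsCyclicallyReduced Γ w)
    {g : ArtinGroup Γ} {n : ℕ} (hn : 0 < n) (hwg : IsConj (eval Γ w) (g ^ n)) {u : Word V}
    (hu : IsCyclicSubword u w) (hu' : IsCyclicSubword (FreeGroup.invRev u) w) (a : V) :
    2 * n * wordCount a u ≤ wordCount a w := by
  rcases Nat.eq_zero_or_pos w.length with hw | hw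
  · obtain ⟨w', hrot, hinf⟩ := hu
    have h1 := hinf.length_le
    rw [hrot.perm.length_eq, hw, Nat.le_zero, List.length_eq_zero_iff] at h1
    simp [h1, wordCount]
  obtain ⟨h, hproj⟩ := hc.exists_proj_eq hn hwg
  obtain ⟨p, hp⟩ := hu.exists_initialWord_eq (hw := hw)
  obtain ⟨q, hq⟩ := hu'.exists_initialWord_eq (hw := hw)
  have hW := isHeapShift_periodicSeq (hw := hw) hc hn hproj
  -- Move the occurrence of `u` by whole periods behind that of its inverse.
  have hp' : initialWord (fun i => periodicSeq w hw (p + q * w.length + i)) u.length = u := by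
    simpa only [Nat.add_right_comm p, periodicSeq_add_mul] using hp
  have hpq : q ≤ p + q * w.length := (Nat.le_mul_of_pos_right q hw).trans (Nat.le_add_left _ _)
  set P := p + q * w.length
  have key := hW.two_mul_genCount_le (p := P) (q := q) (k := u.length) (fun x z hx hz hxz => by
    obtain ⟨i, rfl⟩ := Nat.exists_eq_add_of_le hx
    obtain ⟨j, rfl⟩ := Nat.exists_eq_add_of_le hz
    have hi : i < u.length := by omega
    have hj : j < (FreeGroup.invRev u).length := by simp; omega
    have e1 : periodicSeq w hw (P + i) = u[i] := by
      have : u[i] = (initialWord (fun i => periodicSeq w hw (P + i)) u.length)[i]'(by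
        simpa using hi) := by simp only [hp']
      rw [this]
      simp [initialWord]
    have e2 : periodicSeq w hw (q + j) = (FreeGroup.invRev u)[j] := by
      have : (FreeGroup.invRev u)[j] = (initialWord (fun i => periodicSeq w hw (q + i))
        (FreeGroup.invRev u).length)[j]'(by simpa using hj) := by simp only [hq]
      rw [this]
      simp [initialWord]
    rw [e1, e2]
    have hji : u.length - 1 - j = i := by omega
    simp [FreeGroup.invRev, letterInv, hji]) hpq a
  have hcount : genCount (periodicSeq w hw) a (P + u.length) =
      genCount (periodicSeq w hw) a P + wordCount a u := by
    rw [← wordCount_initialWord, initialWord_add, wordCount_append, hp', wordCount_initialWord]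
  have hwh : wordCount a w = n * wordCount a h := by
    rw [← wordCount_proj (Γ := Γ) (p := ⟨(a, a), Γ.irrefl⟩) w (Or.inl rfl), hproj,
      wordCount_proj _ (Or.inl rfl), wordCount_wordPow]
  rw [hcount, Nat.add_sub_cancel_left] at key
  rw [hwh, Nat.mul_comm 2 n, Nat.mul_assoc]
  exact Nat.mul_le_mul_left n key

end Periodic

end RAAG

theorem mainTheorem3 {V : Type*} [Finite V] (Γ : SimpleGraph V)
    (g : RAAG.ArtinGroup Γ) (n : ℕ) (hn : 0 < n)
    (w : RAAG.Word V) (hw : RAAG.IsCyclicallyReduced Γ w)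
    (hwg : IsConj (RAAG.eval Γ w) (g ^ n))
    (u : RAAG.Word V) (hu : RAAG.IsCyclicSubword u w)
    (hu' : RAAG.IsCyclicSubword (FreeGroup.invRev u) w) :
    (u.length : ℝ) ≤ (w.length : ℝ) / (2 * (n : ℝ)) := by
  classical
  have := Fintype.ofFinite V
  have h : 2 * n * u.length ≤ w.length := by
    rw [RAAG.length_eq_sum_wordCount u, RAAG.length_eq_sum_wordCount w, Finset.mul_sum]
    exact Finset.sum_le_sum fun a _ => hw.wordCount_le hn hwg hu hu' a
  have hn' : (0 : ℝ) < 2 * n := by positivity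
  rw [le_div_iff₀ hn', mul_comm]
  exact_mod_cast h
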